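/- Let $C_1>E_1>0$, $\omega_1>0$, $C_2>E_2>0$, $\omega_2>0$ (so that $E_1,\,-C_1\pm i\omega_1$ and $-C_2,\,E_2\pm i\omega_2$ are the eigenvalues of a vector field at two saddle-foci $O_1$ and $O_2$), and put $$\delta=\frac{C_1C_2}{E_1E_2}>1,\qquad K_\omega=\frac{E_2\omega_1+C_1\omega_2}{E_1E_2}>0 .$$ For real $A,\lambda$ let $\mathcal F_{(A,\lambda)}$ be the (truncated) first return map to the cross-section $\mathrm{Out}(O_2)=\{(x,y): x\in\mathbb R/2\pi\mathbb Z,\ |y|\le 1\}$, that is $$\mathcal F_{(A,\lambda)}(x,y)=\Bigl(x-K_\omega\ln(y+A+\lambda\sin x)\ (\mathrm{mod}\ 2\pi),\ (y+A+\lambda\sin x)^{\delta}\Bigr),$$ defined at the points of $\mathrm{Out}(O_2)$ with $0<y+A+\lambda\sin x\le 1$. It is the composition of the transition $(x,y)\mapsto(x,\,y+A+\lambda\sin x)$ from $\mathrm{Out}(O_2)$ to a neighbourhood of $O_1$, the passage near $O_1$ along the flow $\dot\rho=-C_1\rho,\ \dot\theta=\omega_1,\ \dot z=E_1z$ from $\{\rho=1\}$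 to $\{z=1\}$, the identity, and the passage near $O_2$ along the flow $\dot\rho=E_2\rho,\ \dot\theta=\omega_2,\ \dot z=-C_2z$ from $\{z=1\}$ to $\{\rho=1\}$. Then there is $\varepsilon>0$, depending only on $C_1,E_1,\omega_1,C_2,E_2,\omega_2$, such that for all real $A,\lambda$ with $0<A\le\varepsilon$ and $$1>\frac{\lambda}{A}>\frac{e^{4\pi/K_\omega}-1}{e^{4\pi/K_\omega}-\frac14}$$ there is a compact set $\Lambda\subset\{(x,y)\in\mathrm{Out}(O_2): y\ge 0,\ 0<y+A+\lambda\sin x\le1\}$ with $\mathcal F_{(A,\lambda)}(\Lambda)=\Lambda$ such that 1. $\Lambda$ is a hyperbolic set of $\mathcal F_{(A,\lambda)}$: near $\Lambda$ the map given by this formula on $\{(x,y)\in(\mathbb R/2\pi\mathbb Z)\times\mathbb R:\ y+A+\lambda\sin x>0\}$ is a $C^1$ diffeomorphism onto its image, and there are constants $C>0$, $0<\mu<1$ and a $D\mathcal F_{(A,\lambda)}$-invariant splitting $E^s_p\oplus E^u_p$ of the tangent plane at each $p\in\Lambda$ such that $\|D\mathcal F^n_{(A,\lambda)}(p)v\|\le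 C\mu^n\|v\|$ for $v\in E^s_p$ and $\|v\|\le C\mu^n\|D\mathcal F^n_{(A,\lambda)}(p)v\|$ for $v\in E^u_p$, for all $n\ge0$; 2. $\mathcal F_{(A,\lambda)}|_\Lambda$ is topologically conjugate to the full two-sided shift on two symbols $\{0,1\}^{\mathbb Z}$. -/

import Mathlib

open Set Filter Topology

noncomputable section

/-- Spectral data of the two saddle-foci: the eigenvalues of the linearised vector field are
`E₁, -C₁ ± i ω₁` at `O₁` and `-C₂, E₂ ± i ω₂` at `O₂`. -/
structure SaddleFoci where
  C₁ : ℝ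
  E₁ : ℝ
  ω₁ : ℝ
  C₂ : ℝ
  E₂ : ℝ
  ω₂ : ℝ
  E₁_pos : 0 < E₁
  E₁_lt_C₁ : E₁ < C₁
  ω₁_pos : 0 < ω₁
  E₂_pos : 0 < E₂
  E₂_lt_C₂ : E₂ < C₂
  ω₂_pos : 0 < ω₂

/-- The cylinder `(ℝ / 2πℤ) × ℝ` carrying the coordinates `(x, y)` = (angle, height) of the
walls of the cylindrical neighbourhoods of `O₁` and `O₂`. -/
abbrev Cyl : Type := Real.Angle × ℝ

namespace SaddleFoci

variable (e : SaddleFoci)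

/-- The saddle index `δ = δ₁ δ₂`. -/
def δ : ℝ := (e.C₁ / e.E₁) * (e.C₂ / e.E₂)

/-- The constant `K_ω`. -/
def Kω : ℝ := (e.E₂ * e.ω₁ + e.C₁ * e.ω₂) / (e.E₁ * e.E₂)

/-- The linear flow near `O₁` in cylindrical coordinates `(ρ, θ, z)`. -/
def flow₁ (t : ℝ) (p : ℝ × Real.Angle × ℝ) : ℝ × Real.Angle × ℝ :=
  (Real.exp (-e.C₁ * t) * p.1, p.2.1 + ((e.ω₁ * t : ℝ) : Real.Angle), Real.exp (e.E₁ * t) * p.2.2)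

/-- The linear flow near `O₂` in cylindrical coordinates `(ρ, θ, z)`. -/
def flow₂ (t : ℝ) (p : ℝ × Real.Angle × ℝ) : ℝ × Real.Angle × ℝ :=
  (Real.exp (e.E₂ * t) * p.1, p.2.1 + ((e.ω₂ * t : ℝ) : Real.Angle), Real.exp (-e.C₂ * t) * p.2.2)

/-- Passage near `O₁`, from the wall `ρ = 1` (coordinates `(x, y)`, `0 < y ≤ 1`) to the top
`z = 1` (polar coordinates `(r, φ)`), which is reached at the time `-(log y) / E₁`. -/
def localMap₁ (p : Cyl) : ℝ × Real.Angle :=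
  let q := e.flow₁ (-Real.log p.2 / e.E₁) (1, p.1, p.2)
  (q.1, q.2.1)

/-- Passage near `O₂`, from the top `z = 1` (polar coordinates `(r, φ)`, `0 < r ≤ 1`) to the wall
`ρ = 1` (coordinates `(x, y)`), which is reached at the time `-(log r) / E₂`. -/
def localMap₂ (p : ℝ × Real.Angle) : Cyl :=
  let q := e.flow₂ (-Real.log p.1 / e.E₂) (p.1, p.2, 1)
  (q.2.1, q.2.2)

/-- The local passage `In⁺(O₁) → Out⁺(O₂)`; the transition from `Out(O₁)` to `In(O₂)` is the
identity in these coordinates. -/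
def eta (p : Cyl) : Cyl := e.localMap₂ (e.localMap₁ p)

end SaddleFoci

/-- The transition from `Out(O₂)` to `In(O₁)`. -/
def transition (A lam : ℝ) (p : Cyl) : Cyl := (p.1, p.2 + A + lam * p.1.sin)

/-- The first return map to `Out(O₂)`; it is meaningful on `returnDomain A lam`. -/
def SaddleFoci.returnMap (e : SaddleFoci) (A lam : ℝ) (p : Cyl) : Cyl :=
  e.eta (transition A lam p)

/-- The upper half `0 ≤ y ≤ 1` of the cross-section `Out(O₂)`, the wall of the cylindrical
neighbourhood of `O₂` (rescaled so that `|y| ≤ 1`). -/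
def outPlus : Set Cyl := {p | 0 ≤ p.2 ∧ p.2 ≤ 1}

/-- Points that the transition maps into `In⁺(O₁) \ Wˢ(O₁) = {0 < y ≤ 1}`. -/
def returnDomain (A lam : ℝ) : Set Cyl :=
  {p | 0 < (transition A lam p).2 ∧ (transition A lam p).2 ≤ 1}

/-- The explicit formula of the first return map. -/
theorem SaddleFoci.returnMap_eq (e : SaddleFoci) (A lam : ℝ) (p : Cyl)
    (hp : 0 < p.2 + A + lam * p.1.sin) :
    e.returnMap A lam p =
      (p.1 - ((e.Kω * Real.log (p.2 + A + lam * p.1.sin) : ℝ) : Real.Angle),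
        (p.2 + A + lam * p.1.sin) ^ e.δ) := by
  have h1 := e.E₁_pos.ne'
  have h2 := e.E₂_pos.ne'
  simp only [returnMap, eta, transition, localMap₁, localMap₂, flow₁, flow₂, mul_one,
    Real.log_exp, Kω, δ, Prod.mk.injEq]
  constructor
  · rw [add_assoc, ← Real.Angle.coe_add, sub_eq_add_neg, ← Real.Angle.coe_neg]
    congr 2
    field_simp
    ring
  · rw [Real.rpow_def_of_pos hp]
    congr 1
    field_simp

/-- The universal covering `ℝ² → (ℝ / 2πℤ) × ℝ`. -/
def cylProj (q : ℝ × ℝ) : Cyl := ((q.1 : Real.Angle), q.2)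

/-- `G` has at `p` the derivative `L`, where every tangent plane of the cylinder is identified
with `ℝ × ℝ` through the covering: some local lift of `G` has the derivative `L`. -/
def HasCylDerivAt (G : Cyl → Cyl) (L : ℝ × ℝ →L[ℝ] ℝ × ℝ) (p : Cyl) : Prop :=
  ∃ (g : ℝ × ℝ → ℝ × ℝ) (q : ℝ × ℝ), cylProj q = p ∧
    (∀ᶠ q' in 𝓝 q, cylProj (g q') = G (cylProj q')) ∧ HasFDerivAt g L q

/-- The derivative of the iterate `G^n` at `p` by the chain rule, from the derivative `D` of `G`. -/
def iterDeriv (G : Cyl → Cyl) (D : Cyl → (ℝ × ℝ →L[ℝ] ℝ × ℝ)) : ℕ → Cyl → (ℝ × ℝ →L[ℝ] ℝ × ℝ)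
  | 0, _ => ContinuousLinearMap.id ℝ (ℝ × ℝ)
  | n + 1, p => (iterDeriv G D n (G p)).comp (D p)

/-- `Λ` is a (uniformly) hyperbolic set of `G`: it is compact and `G(Λ) = Λ`, on an open
neighbourhood `U` of `Λ` the map `G` is a `C¹` diffeomorphism onto its image, and over `Λ` the
tangent bundle has a `DG`-invariant splitting `Eˢ ⊕ Eᵘ` whose first summand is uniformly contracted
and whose second summand is uniformly expanded. -/
def IsHyperbolicSet (G : Cyl → Cyl) (Λ : Set Cyl) : Prop :=
  IsCompact Λ ∧ G '' Λ = Λ ∧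
  ∃ (U : Set Cyl) (D : Cyl → (ℝ × ℝ →L[ℝ] ℝ × ℝ)),
    IsOpen U ∧ Λ ⊆ U ∧ InjOn G U ∧ (∀ p ∈ U, HasCylDerivAt G (D p) p) ∧ ContinuousOn D U ∧
    (∀ p ∈ U, Function.Bijective (D p)) ∧
    ∃ (Es Eu : Cyl → Submodule ℝ (ℝ × ℝ)) (C μ : ℝ), 0 < C ∧ 0 < μ ∧ μ < 1 ∧
      ∀ p ∈ Λ, IsCompl (Es p) (Eu p) ∧
        (Es p).map (D p : ℝ × ℝ →ₗ[ℝ] ℝ × ℝ) = Es (G p) ∧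
        (Eu p).map (D p : ℝ × ℝ →ₗ[ℝ] ℝ × ℝ) = Eu (G p) ∧
        (∀ v ∈ Es p, ∀ n : ℕ, ‖iterDeriv G D n p v‖ ≤ C * μ ^ n * ‖v‖) ∧
        (∀ v ∈ Eu p, ∀ n : ℕ, ‖v‖ ≤ C * μ ^ n * ‖iterDeriv G D n p v‖)

/-- `G` maps `Λ` into itself and `G|_Λ` is topologically conjugate to the full two-sided shift
on `m` symbols. -/
def IsConjFullShift (G : Cyl → Cyl) (Λ : Set Cyl) (m : ℕ) : Prop :=
  ∃ (hG : MapsTo G Λ Λ) (h : Λ ≃ₜ (ℤ → Fin m)),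
    Function.Semiconj h (hG.restrict G Λ Λ) (SymbolicDynamics.FullShift.shift (1 : ℤ))

end

noncomputable section

/-! Near x = π the term `lam * sin x` lowers the height `y + A + lam * sin x`, so the rotation `-Kω
* log(height)` grows quickly there. Work in a thin rectangle x = π + t, y = A ω v with 0 ≤ t ≤ β <
π/2 and 0 ≤ v ≤ 1. There the height is A(1 - (lam/A) sin t + ω v). Along each segment of constant v
the logarithm of the bracket falls from at least 0 to at most -4π/Kω, so the image winds at least
two full turns further than the segment itself. Aligning the image with an integer number of turns
costs less than one turn, and what remains covers two consecutive lifts of the angular interval.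
Their numbers are the symbols 0 and 1. Since cos t ≥ cos β > 0, the angle is expanded. Since δ > 1,
the height contributes a factor A^(δ-1), so for small A it is strongly contracted.

An orbit with a prescribed itinerary solves a boundary value problem: the angle at time n is
determined by the next angle and the present height, and the height at time n by the previous point.
This is a contraction on bi-infinite sequences (`Horseshoe.isLocalContraction_orbitOperator`). Its
unique fixed point is the orbit, and locality of the operator makes the orbit depend continuously on
the itinerary. As the return map is injective, the coding is a homeomorphism from the shift space
onto its image Λ.

Hyperbolicity uses the same device. Along an orbit the rescaled derivatives satisfy `IsDominated`,
the slopes of invariant lines are fixed points of contractions on sequences, and uniqueness of these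
slopes gives invariance of the splitting. `SaddleFoci.exists_horseshoe` supplies the constants; the
hypothesis on `lam / A` enters only there. -/

/-! ### Fixed points of local contractions on sequence spaces -/

/-- A map of bi-infinite sequences whose `n`-th output depends on the inputs at `n - 1`, `n`,
`n + 1` only, and contracts by the factor `q`. -/
def IsLocalContraction {X : Type*} [MetricSpace X] (q : ℝ) (T : (ℤ → X) → ℤ → X) : Prop :=
  ∀ (n : ℤ) (D : ℝ) (P Q : ℤ → X),
    (∀ m : ℤ, |m - n| ≤ 1 → dist (P m) (Q m) ≤ D) → dist (T P n) (T Q n) ≤ q * D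

namespace IsLocalContraction

variable {X : Type*} [MetricSpace X] {q : ℝ}

/-- Picard iteration in each coordinate. Boundedness of X makes the geometric error estimate uniform
in the index, and this uniformity lets the contraction inequality pass to the limit. -/
theorem exists_fixedPoint [CompleteSpace X] [Nonempty X] {T : (ℤ → X) → ℤ → X}
    (hT : IsLocalContraction q T) (hq0 : 0 ≤ q) (hq1 : q < 1) {C : ℝ}
    (hC : ∀ x y : X, dist x y ≤ C) :
    ∃ P : ℤ → X, T P = P := by
  let x₀ : X := Classical.arbitrary X
  let u : ℕ → ℤ → X := fun m => T^[m] (fun _ => x₀)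
  have hu : ∀ m, u (m + 1) = T (u m) := fun m => Function.iterate_succ_apply' T m _
  have hd : ∀ m n, dist (u m n) (u (m + 1) n) ≤ C * q ^ m := by
    intro m
    induction m with
    | zero => intro n; simpa using hC _ _
    | succ m ih =>
      intro n
      rw [hu (m + 1), hu m]
      refine (hT n (C * q ^ m) _ _ fun j _ => ?_).trans (le_of_eq (by ring))
      rw [← hu m]
      exact ih j
  choose P hP using fun n => cauchySeq_tendsto_of_complete
    (cauchySeq_of_le_geometric q C hq1 fun m => hd m n)
  have hlim : ∀ n m, dist (u m n) (P n) ≤ C * q ^ m / (1 - q) := fun n m =>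
    dist_le_of_le_geometric_of_tendsto q C hq1 (fun m => hd m n) (hP n) m
  refine ⟨P, funext fun n => ?_⟩
  have h1 : Tendsto (fun m => u (m + 1) n) atTop (𝓝 (T P n)) := by
    rw [tendsto_iff_dist_tendsto_zero]
    refine squeeze_zero (fun _ => dist_nonneg)
      (fun m => ?_ : ∀ m, _ ≤ q * (C * q ^ m / (1 - q))) ?_
    · rw [hu m]
      exact hT n _ _ _ fun j _ => hlim j m
    · have := tendsto_pow_atTop_nhds_zero_of_lt_one hq0 hq1
      simpa using (((this.const_mul C).div_const (1 - q)).const_mul q)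
  exact tendsto_nhds_unique h1 ((tendsto_add_atTop_iff_nat 1).2 (hP n))

/-- Each application of the contraction gains a factor q and widens the index window by one.
Agreement of the operators on a window of radius N is thus enough for m steps at any index at
distance at least m from its ends. -/
theorem dist_fixedPoint_le {T T' : (ℤ → X) → ℤ → X} (hT : IsLocalContraction q T) {C : ℝ}
    (hC : ∀ x y : X, dist x y ≤ C) {P Q : ℤ → X} (hP : T P = P) (hQ : T' Q = Q) {N : ℕ}
    (hTT' : ∀ n : ℤ, |n| ≤ N → T Q n = T' Q n) (m : ℕ) :
    ∀ n : ℤ, |n| + m ≤ N → dist (P n) (Q n) ≤ q ^ m * C := by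
  induction m with
  | zero => intro n _; simpa using hC _ _
  | succ m ih =>
    intro n hn
    push_cast at hn
    rw [← hP, ← hQ, ← hTT' n (by lia), pow_succ', mul_assoc]
    refine hT n _ _ _ fun j hj => ih j ?_
    have : |j| ≤ |j - n| + |n| := by simpa using abs_add_le (j - n) n
    lia

theorem fixedPoint_unique {T : (ℤ → X) → ℤ → X} (hT : IsLocalContraction q T)
    (hq0 : 0 ≤ q) (hq1 : q < 1) {C : ℝ}
    (hC : ∀ x y : X, dist x y ≤ C) {P Q : ℤ → X} (hP : T P = P) (hQ : T Q = Q) : P = Q := by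
  funext n
  refine dist_le_zero.1 ?_
  have h : ∀ m : ℕ, dist (P n) (Q n) ≤ q ^ m * C := fun m =>
    hT.dist_fixedPoint_le hC hP hQ (N := n.natAbs + m) (fun _ _ => rfl) m n (by simp)
  refine ge_of_tendsto' (x := atTop) ?_ h
  simpa using (tendsto_pow_atTop_nhds_zero_of_lt_one hq0 hq1).mul_const C

/-- Parameters that agree on a long central window have fixed points that are close at index 0,
which is continuity for the product topology. -/
theorem continuous_fixedPoint {S : Type*} [TopologicalSpace S] [DiscreteTopology S]
    {T : (ℤ → S) → (ℤ → X) → ℤ → X} (hT : ∀ k, IsLocalContraction q (T k))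
    (hq0 : 0 ≤ q) (hq1 : q < 1) {C : ℝ} (hC : ∀ x y : X, dist x y ≤ C)
    (hloc : ∀ k k' R n, k n = k' n → T k R n = T k' R n)
    {P : (ℤ → S) → ℤ → X} (hP : ∀ k, T k (P k) = P k) :
    Continuous fun k => P k 0 := by
  rw [continuous_iff_continuousAt]
  intro k
  rw [ContinuousAt, Metric.tendsto_nhds]
  intro ε hε
  have hlim : Tendsto (fun m : ℕ => q ^ m * C) atTop (𝓝 0) := by
    simpa using (tendsto_pow_atTop_nhds_zero_of_lt_one hq0 hq1).mul_const C
  obtain ⟨m, hm⟩ := (hlim.eventually_lt_const hε).exists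
  have hev : ∀ᶠ k' in 𝓝 k, ∀ n ∈ Finset.Icc (-m : ℤ) m, k' n = k n := by
    rw [Filter.eventually_all_finset]
    intro n _
    exact (continuous_apply n).continuousAt.eventually
      ((isOpen_discrete {k n}).mem_nhds rfl)
  filter_upwards [hev] with k' hk'
  refine ((hT k').dist_fixedPoint_le hC (hP k') (hP k) (N := m) (fun n hn => ?_) m 0
    (by simp)).trans_lt hm
  exact hloc _ _ _ _ (hk' n (by rw [Finset.mem_Icc]; exact abs_le.1 hn))

end IsLocalContraction

/-- Stated for a recursion in either direction of time: unstable slopes use j = -1, stable slopes j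
= 1. -/
theorem existsUnique_sequence_of_contraction {f : ℤ → ℝ → ℝ} {j : ℤ} (hj : |j| ≤ 1)
    (hmaps : ∀ n x, |x| ≤ 1 / 2 → |f n x| ≤ 1 / 2)
    (hlip : ∀ n x y, |x| ≤ 1 / 2 → |y| ≤ 1 / 2 → |f n x - f n y| ≤ 1 / 2 * |x - y|) :
    ∃! s : ℤ → ℝ, (∀ n, |s n| ≤ 1 / 2) ∧ ∀ n, s n = f n (s (n + j)) := by
  let X := {x : ℝ // |x| ≤ 1 / 2}
  have : CompleteSpace X :=
    (isClosed_le continuous_abs continuous_const).isComplete.completeSpace_coe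
  have : Nonempty X := ⟨⟨0, by norm_num⟩⟩
  let T : (ℤ → X) → ℤ → X := fun s n => ⟨f n (s (n + j)), hmaps _ _ (s _).2⟩
  have hT : IsLocalContraction (1 / 2) T := fun n D P Q h => by
    have h1 := hlip n _ _ (P (n + j)).2 (Q (n + j)).2
    have h2 : |(P (n + j) : ℝ) - Q (n + j)| ≤ D := h (n + j) (by simpa using hj)
    change |f n (P (n + j)) - f n (Q (n + j))| ≤ _
    linarith
  have hC : ∀ x y : X, dist x y ≤ 1 := fun x y => by
    have hx := abs_le.1 x.2
    have hy := abs_le.1 y.2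
    change |(x : ℝ) - y| ≤ 1
    rw [abs_le]
    constructor <;> linarith
  obtain ⟨P, hP⟩ := hT.exists_fixedPoint (by norm_num) (by norm_num) hC
  refine ⟨fun n => P n, ⟨fun n => (P n).2, fun n => ?_⟩, fun s hs => ?_⟩
  · exact congrArg Subtype.val (congrFun hP n).symm
  · let Q : ℤ → X := fun n => ⟨s n, hs.1 n⟩
    have hQ : T Q = Q := funext fun n => Subtype.ext (hs.2 n).symm
    have := hT.fixedPoint_unique (by norm_num) (by norm_num) hC hQ hP
    exact funext fun n => congrArg Subtype.val (congrFun this n)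

/-! ### Invariant slopes of dominated cocycles -/

/-- Smallness conditions on a matrix `(a b; c d)` under which the first axis is nearly
expanded and the second axis nearly contracted. -/
structure IsDominated (ε a b c d : ℝ) : Prop where
  pos : 0 < ε
  le : ε ≤ 1 / 4
  ha : 1 + 3 * ε ≤ a
  hb : |b| ≤ ε
  hc : |c| ≤ ε
  hd : |d| ≤ ε

namespace IsDominated

variable {ε a b c d : ℝ}

/-- Solving aσ + b = (cσ + d)σ' for σ gives (-b + dσ')/(a - cσ'), the slope transformation of the
matrix in this conclusion. Estimates for unstable slopes therefore also serve the stable ones, with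
time reversed. -/
theorem dual (h : IsDominated ε a b c d) : IsDominated ε a (-c) (-b) d :=
  ⟨h.pos, h.le, h.ha, by simpa using h.hc, by simpa using h.hb, h.hd⟩

theorem le_denom (h : IsDominated ε a b c d) {x : ℝ} (hx : |x| ≤ 1 / 2) :
    a - ε / 2 ≤ a + b * x := by
  have : |b * x| ≤ ε * (1 / 2) := by
    rw [abs_mul]
    exact mul_le_mul h.hb hx (abs_nonneg _) h.pos.le
  linarith [(abs_le.1 this).1]

theorem abs_num_le (h : IsDominated ε a b c d) {x : ℝ} (hx : |x| ≤ 1 / 2) :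
    |c + d * x| ≤ 2 * ε := by
  have : |d * x| ≤ ε * (1 / 2) := by
    rw [abs_mul]
    exact mul_le_mul h.hd hx (abs_nonneg _) h.pos.le
  linarith [abs_add_le c (d * x), h.hc, h.pos]

theorem one_le_denom (h : IsDominated ε a b c d) {x : ℝ} (hx : |x| ≤ 1 / 2) :
    1 + 2 * ε ≤ a + b * x := by
  linarith [h.le_denom hx, h.ha, h.pos]

theorem denom_pos (h : IsDominated ε a b c d) {x : ℝ} (hx : |x| ≤ 1 / 2) : 0 < a + b * x := by
  linarith [h.one_le_denom hx, h.pos]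

theorem abs_slope_le (h : IsDominated ε a b c d) {x : ℝ} (hx : |x| ≤ 1 / 2) :
    |(c + d * x) / (a + b * x)| ≤ 1 / 2 := by
  rw [abs_div, abs_of_pos (h.denom_pos hx), div_le_iff₀ (h.denom_pos hx)]
  linarith [h.abs_num_le hx, h.one_le_denom hx, h.le]

/-- The difference of two values of a Möbius map is the determinant times x - y over the product of
the denominators. The determinant is at most aε + ε², the product at least (a - ε/2)². -/
theorem abs_slope_sub_slope_le (h : IsDominated ε a b c d) {x y : ℝ} (hx : |x| ≤ 1 / 2)
    (hy : |y| ≤ 1 / 2) :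
    |(c + d * x) / (a + b * x) - (c + d * y) / (a + b * y)| ≤ 1 / 2 * |x - y| := by
  have hx' := h.denom_pos hx
  have hy' := h.denom_pos hy
  have hdet : |a * d - b * c| ≤ a * ε + ε * ε := by
    have ha : |a| = a := abs_of_pos (by linarith [h.ha, h.pos])
    refine (abs_sub _ _).trans ?_
    rw [abs_mul, abs_mul, ha]
    have := mul_le_mul h.hb h.hc (abs_nonneg _) h.pos.le
    have := mul_le_mul_of_nonneg_left h.hd (by linarith [h.ha, h.pos] : 0 ≤ a)
    linarith
  have hden : (a - ε / 2) * (a - ε / 2) ≤ (a + b * x) * (a + b * y) := by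
    have : 0 ≤ a - ε / 2 := by linarith [h.ha, h.pos]
    exact mul_le_mul (h.le_denom hx) (h.le_denom hy) this hx'.le
  have heq : (c + d * x) / (a + b * x) - (c + d * y) / (a + b * y)
      = (a * d - b * c) * (x - y) / ((a + b * x) * (a + b * y)) := by
    rw [div_sub_div _ _ hx'.ne' hy'.ne']
    congr 1
    ring
  rw [heq, abs_div, abs_mul, abs_of_pos (mul_pos hx' hy'), div_le_iff₀ (mul_pos hx' hy')]
  have : |a * d - b * c| ≤ 1 / 2 * ((a + b * x) * (a + b * y)) := by
    nlinarith [h.ha, h.pos, h.le]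
  nlinarith [abs_nonneg (x - y)]

end IsDominated

section Cocycle

variable {ε : ℝ} {a b c d : ℤ → ℝ}

/-- The slopes of the unstable directions along an orbit. -/
theorem existsUnique_unstable_slopes (h : ∀ n, IsDominated ε (a n) (b n) (c n) (d n)) :
    ∃! τ : ℤ → ℝ, (∀ n, |τ n| ≤ 1 / 2) ∧
      ∀ n, c n + d n * τ n = (a n + b n * τ n) * τ (n + 1) := by
  have := existsUnique_sequence_of_contraction
    (f := fun n x => (c (n - 1) + d (n - 1) * x) / (a (n - 1) + b (n - 1) * x)) (j := -1)
    (by norm_num) (fun n x hx => (h _).abs_slope_le hx)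
    (fun n x y hx hy => (h _).abs_slope_sub_slope_le hx hy)
  refine (existsUnique_congr fun τ => and_congr_right fun hτ => ?_).1 this
  refine ⟨fun H n => ?_, fun H n => ?_⟩
  · have := H (n + 1)
    simp only [add_sub_cancel_right, add_neg_cancel_right] at this
    rw [eq_div_iff ((h _).denom_pos (hτ _)).ne'] at this
    linarith
  · have := H (n - 1)
    rw [sub_add_cancel] at this
    rw [← sub_eq_add_neg, eq_div_iff ((h _).denom_pos (hτ _)).ne', this, mul_comm]

/-- The slopes of the stable directions along an orbit. -/
theorem existsUnique_stable_slopes (h : ∀ n, IsDominated ε (a n) (b n) (c n) (d n)) :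
    ∃! σ : ℤ → ℝ, (∀ n, |σ n| ≤ 1 / 2) ∧
      ∀ n, a n * σ n + b n = (c n * σ n + d n) * σ (n + 1) := by
  have := existsUnique_sequence_of_contraction
    (f := fun n x => (-b n + d n * x) / (a n + -c n * x)) (j := 1)
    (by norm_num) (fun n x hx => (h _).dual.abs_slope_le hx)
    (fun n x y hx hy => (h _).dual.abs_slope_sub_slope_le hx hy)
  refine (existsUnique_congr fun σ => and_congr_right fun hσ => forall_congr' fun n => ?_).1 this
  rw [eq_div_iff ((h _).dual.denom_pos (hσ _)).ne']
  constructor <;> intro H <;> linarith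

end Cocycle

/-! ### The rescaled return map on the rectangle -/

theorem SaddleFoci.Kω_pos (e : SaddleFoci) : 0 < e.Kω := by
  have := e.E₁_pos
  have := e.E₂_pos
  have := e.ω₁_pos
  have := e.ω₂_pos
  have : 0 < e.C₁ := e.E₁_pos.trans e.E₁_lt_C₁
  unfold Kω
  positivity

theorem SaddleFoci.one_lt_δ (e : SaddleFoci) : 1 < e.δ :=
  one_lt_mul_of_lt_of_le ((one_lt_div e.E₁_pos).2 e.E₁_lt_C₁)
    ((one_le_div e.E₂_pos).2 e.E₂_lt_C₂.le)

/-- Data of a horseshoe of the return map in the rectangle `x = π + t`, `y = A * ω * v` with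
`0 ≤ t ≤ β`, `0 ≤ v ≤ 1`: in this rectangle the angular coordinate is expanded, the height is
contracted, and two lifts of the angular interval, numbered `k₀` and `k₀ + 1`, are covered. -/
structure Horseshoe (e : SaddleFoci) (A lam : ℝ) where
  β : ℝ
  ω : ℝ
  ε : ℝ
  k₀ : ℤ
  A_pos : 0 < A
  A_le : A ≤ 1 / 2
  lam_pos : 0 < lam
  lam_lt : lam < A
  β_pos : 0 < β
  β_lt : β < Real.pi / 2
  ω_pos : 0 < ω
  ω_le : ω ≤ 1
  ε_pos : 0 < ε
  ε_le : ε ≤ 1 / 4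
  -- The next three fields bound the derivative in rescaled coordinates: angular expansion (the 6
  -- becomes 3 because the height is at most 2), the effect of v on the angle, and the radial
  -- derivative, whose extra factor ω pays for the division by ω in the rescaled height.
  expand : 6 * ε ≤ e.Kω * (lam / A * Real.cos β)
  bend : e.Kω * ω ≤ ε * (1 - lam / A * Real.sin β)
  squeeze : e.δ * (A ^ (e.δ - 1) * 2 ^ (e.δ - 1)) ≤ ε * ω
  cover_left : -(e.Kω * Real.log A) ≤ 2 * Real.pi * k₀
  cover_right : 2 * Real.pi * (k₀ + 1) ≤
    -(e.Kω * Real.log A) - e.Kω * Real.log (1 - lam / A * Real.sin β + ω)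

namespace Horseshoe

variable {e : SaddleFoci} {A lam : ℝ}

theorem ratio_pos (h : Horseshoe e A lam) : 0 < lam / A := div_pos h.lam_pos h.A_pos

theorem ratio_lt (h : Horseshoe e A lam) : lam / A < 1 := (div_lt_one h.A_pos).2 h.lam_lt

variable (h : Horseshoe e A lam)

/-- The rectangle carrying the horseshoe, in rescaled coordinates. -/
abbrev Rect : Type := Icc (0 : ℝ) h.β × Icc (0 : ℝ) 1

instance : Nonempty h.Rect := ⟨(⟨0, le_rfl, h.β_pos.le⟩, ⟨0, le_rfl, zero_le_one⟩)⟩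

/-- The rescaled distance from the stable manifold of `O₁`. -/
def height (t v : ℝ) : ℝ := 1 - lam / A * Real.sin t + h.ω * v

/-- The angular component of the return map. -/
def angularMap (t v : ℝ) : ℝ := t - e.Kω * Real.log A - e.Kω * Real.log (h.height t v)

/-- The rescaled radial component of the return map. -/
def radialMap (t v : ℝ) : ℝ := A ^ (e.δ - 1) * h.height t v ^ e.δ / h.ω

theorem cos_pos : 0 < Real.cos h.β :=
  Real.cos_pos_of_mem_Ioo ⟨by linarith [h.β_pos, Real.pi_pos], h.β_lt⟩

theorem gap_pos : 0 < 1 - lam / A * Real.sin h.β := by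
  have := mul_le_mul_of_nonneg_left (Real.sin_le_one h.β) h.ratio_pos.le
  linarith [h.ratio_lt]

variable {t t' v v' : ℝ}

theorem gap_le_height (ht : t ∈ Icc 0 h.β) (hv : v ∈ Icc (0 : ℝ) 1) :
    1 - lam / A * Real.sin h.β ≤ h.height t v := by
  have h1 : Real.sin t ≤ Real.sin h.β :=
    Real.sin_le_sin_of_le_of_le_pi_div_two (by linarith [ht.1, Real.pi_pos]) h.β_lt.le ht.2
  have h2 := mul_le_mul_of_nonneg_left h1 h.ratio_pos.le
  have h3 := mul_nonneg h.ω_pos.le hv.1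
  unfold height
  linarith

theorem height_pos (ht : t ∈ Icc 0 h.β) (hv : v ∈ Icc (0 : ℝ) 1) : 0 < h.height t v :=
  h.gap_pos.trans_le (h.gap_le_height ht hv)

theorem height_le (ht : t ∈ Icc 0 h.β) (hv : v ∈ Icc (0 : ℝ) 1) : h.height t v ≤ 2 := by
  have h1 : 0 ≤ Real.sin t :=
    Real.sin_nonneg_of_nonneg_of_le_pi ht.1 (by linarith [ht.2, h.β_lt, Real.pi_pos])
  have h2 := mul_nonneg h.ratio_pos.le h1
  have h3 := mul_le_mul h.ω_le hv.2 hv.1 zero_le_one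
  unfold height
  linarith

theorem cos_le_cos (ht : t ∈ Icc 0 h.β) : Real.cos h.β ≤ Real.cos t :=
  Real.cos_le_cos_of_nonneg_of_le_pi ht.1 (by linarith [h.β_lt, Real.pi_pos]) ht.2

/-- The mean value inequality bounds the increment of sin below by cos β, and log s ≤ s - 1 turns
this into a bound for the logarithms. -/
theorem le_angularMap_sub (ht : t ∈ Icc 0 h.β) (ht' : t' ∈ Icc 0 h.β) (htt' : t' ≤ t)
    (hv : v ∈ Icc (0 : ℝ) 1) :
    (1 + 3 * h.ε) * (t - t') ≤ h.angularMap t v - h.angularMap t' v := by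
  have hsin : Real.cos h.β * (t - t') ≤ Real.sin t - Real.sin t' := by
    refine (convex_Icc 0 h.β).mul_sub_le_image_sub_of_le_deriv Real.continuous_sin.continuousOn
      Real.differentiable_sin.differentiableOn (fun x hx => ?_) _ ht' _ ht htt'
    rw [Real.deriv_sin]
    exact h.cos_le_cos (interior_subset hx)
  have hu := h.height_pos ht hv
  have hu' := h.height_pos ht' hv
  have hlog : lam / A * (Real.sin t - Real.sin t') / 2
      ≤ Real.log (h.height t' v) - Real.log (h.height t v) := by
    have h1 := Real.log_le_sub_one_of_pos (div_pos hu hu')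
    rw [Real.log_div hu.ne' hu'.ne'] at h1
    have h2 : 1 - h.height t v / h.height t' v
        = lam / A * (Real.sin t - Real.sin t') / h.height t' v := by
      rw [one_sub_div hu'.ne']
      congr 1
      unfold height
      ring
    have h3 : lam / A * (Real.sin t - Real.sin t') / 2
        ≤ lam / A * (Real.sin t - Real.sin t') / h.height t' v := by
      refine div_le_div_of_nonneg_left (mul_nonneg h.ratio_pos.le ?_) hu' (h.height_le ht' hv)
      exact (mul_nonneg h.cos_pos.le (sub_nonneg.2 htt')).trans hsin
    linarith
  have h1 := mul_le_mul_of_nonneg_left hlog e.Kω_pos.le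
  have h2 := mul_le_mul_of_nonneg_left hsin (mul_pos e.Kω_pos h.ratio_pos).le
  have h3 := mul_le_mul_of_nonneg_right h.expand (sub_nonneg.2 htt')
  unfold angularMap
  linarith

theorem mul_abs_sub_le_abs_angularMap_sub (ht : t ∈ Icc 0 h.β) (ht' : t' ∈ Icc 0 h.β)
    (hv : v ∈ Icc (0 : ℝ) 1) :
    (1 + 3 * h.ε) * |t - t'| ≤ |h.angularMap t v - h.angularMap t' v| := by
  rcases le_total t' t with H | H
  · rw [abs_of_nonneg (sub_nonneg.2 H)]
    exact (h.le_angularMap_sub ht ht' H hv).trans (le_abs_self _)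
  · rw [abs_sub_comm, abs_sub_comm (h.angularMap t v), abs_of_nonneg (sub_nonneg.2 H)]
    exact (h.le_angularMap_sub ht' ht H hv).trans (le_abs_self _)

theorem angularMap_sub_le (ht : t ∈ Icc 0 h.β) (hv : v ∈ Icc (0 : ℝ) 1)
    (hv' : v' ∈ Icc (0 : ℝ) 1) :
    h.angularMap t v - h.angularMap t v' ≤ h.ε * |v - v'| := by
  have hu := h.height_pos ht hv
  have hu' := h.height_pos ht hv'
  have h1 := Real.log_le_sub_one_of_pos (div_pos hu' hu)
  rw [Real.log_div hu'.ne' hu.ne', div_sub_one hu.ne'] at h1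
  have h2 : (h.height t v' - h.height t v) / h.height t v
      ≤ h.ω * |v - v'| / (1 - lam / A * Real.sin h.β) := by
    refine div_le_div₀ (mul_nonneg h.ω_pos.le (abs_nonneg _)) ?_ h.gap_pos
      (h.gap_le_height ht hv)
    have := mul_le_mul_of_nonneg_left (neg_abs_le (v - v')) h.ω_pos.le
    unfold height
    linarith
  have h3 : e.Kω * (h.ω * |v - v'| / (1 - lam / A * Real.sin h.β)) ≤ h.ε * |v - v'| := by
    rw [← mul_div_assoc, div_le_iff₀ h.gap_pos]
    have := mul_le_mul_of_nonneg_right h.bend (abs_nonneg (v - v'))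
    linarith
  have h4 := mul_le_mul_of_nonneg_left (h1.trans h2) e.Kω_pos.le
  unfold angularMap
  linarith

theorem abs_angularMap_sub_le (ht : t ∈ Icc 0 h.β) (hv : v ∈ Icc (0 : ℝ) 1)
    (hv' : v' ∈ Icc (0 : ℝ) 1) :
    |h.angularMap t v - h.angularMap t v'| ≤ h.ε * |v - v'| := by
  rw [abs_le]
  have h1 := h.angularMap_sub_le ht hv hv'
  have h2 := h.angularMap_sub_le ht hv' hv
  rw [abs_sub_comm] at h2
  constructor <;> linarith

/-- Intermediate value theorem on a segment of constant v. At t = 0 the height is at least 1 and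
`cover_left` applies; at t = β `cover_right` applies. -/
theorem exists_angularMap_eq (i : Fin 2) {z : ℝ} (hz : z ∈ Icc 0 h.β) (hv : v ∈ Icc (0 : ℝ) 1) :
    ∃ t ∈ Icc 0 h.β, h.angularMap t v = z + 2 * Real.pi * (h.k₀ + (i : ℕ)) := by
  have h0 : (0 : ℝ) ∈ Icc 0 h.β := ⟨le_rfl, h.β_pos.le⟩
  have h1 : h.β ∈ Icc 0 h.β := ⟨h.β_pos.le, le_rfl⟩
  have hcont : ContinuousOn (fun t => h.angularMap t v) (Icc 0 h.β) := by
    unfold angularMap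
    refine ContinuousOn.sub (by fun_prop) (ContinuousOn.mul continuousOn_const ?_)
    refine ContinuousOn.log ?_ fun t ht => (h.height_pos ht hv).ne'
    unfold height
    fun_prop
  have hi0 : (0 : ℝ) ≤ (i : ℕ) := Nat.cast_nonneg _
  have hi1 : ((i : ℕ) : ℝ) ≤ 1 := by exact_mod_cast Nat.lt_succ_iff.1 i.2
  refine intermediate_value_Icc h.β_pos.le hcont ⟨?_, ?_⟩
  · have hlog : 0 ≤ Real.log (h.height 0 v) := by
      refine Real.log_nonneg ?_
      have := mul_nonneg h.ω_pos.le hv.1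
      simp only [height, Real.sin_zero]
      linarith
    have h2 := mul_nonneg e.Kω_pos.le hlog
    have h3 := mul_nonneg Real.pi_pos.le hi0
    simp only [angularMap]
    linarith [h.cover_left, hz.1]
  · have hlog : Real.log (h.height h.β v) ≤ Real.log (1 - lam / A * Real.sin h.β + h.ω) := by
      refine Real.log_le_log (h.height_pos h1 hv) ?_
      have := mul_le_mul_of_nonneg_left hv.2 h.ω_pos.le
      unfold height
      linarith
    have h2 := mul_le_mul_of_nonneg_left hlog e.Kω_pos.le
    have h3 := mul_le_mul_of_nonneg_left hi1 Real.pi_pos.le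
    simp only [angularMap]
    linarith [h.cover_right, hz.2]

/-- Smallness of A enters through this bound. It controls the range of the radial map, its Lipschitz
constant and the second row of the derivative. -/
theorem rescaled_deriv_le {u : ℝ} (hu : 0 < u) (hu2 : u ≤ 2) :
    A ^ (e.δ - 1) * (e.δ * u ^ (e.δ - 1)) ≤ h.ε * h.ω := by
  have h1 : u ^ (e.δ - 1) ≤ 2 ^ (e.δ - 1) :=
    Real.rpow_le_rpow hu.le hu2 (by linarith [e.one_lt_δ])
  have h2 : 0 ≤ A ^ (e.δ - 1) * e.δ :=
    mul_nonneg (Real.rpow_nonneg h.A_pos.le _) (by linarith [e.one_lt_δ])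
  have := mul_le_mul_of_nonneg_left h1 h2
  linarith [h.squeeze]

theorem radialMap_mem (ht : t ∈ Icc 0 h.β) (hv : v ∈ Icc (0 : ℝ) 1) :
    h.radialMap t v ∈ Icc (0 : ℝ) 1 := by
  have hu := h.height_pos ht hv
  have hA := Real.rpow_nonneg h.A_pos.le (e.δ - 1)
  have hw := Real.rpow_nonneg hu.le (e.δ - 1)
  constructor
  · exact div_nonneg (mul_nonneg hA (Real.rpow_nonneg hu.le _)) h.ω_pos.le
  · have h1 := h.rescaled_deriv_le hu (h.height_le ht hv)
    have h2 : h.height t v ^ e.δ = h.height t v ^ (e.δ - 1) * h.height t v := by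
      rw [← Real.rpow_add_one hu.ne', sub_add_cancel]
    have h3 : A ^ (e.δ - 1) * h.height t v ^ (e.δ - 1)
        ≤ A ^ (e.δ - 1) * (e.δ * h.height t v ^ (e.δ - 1)) :=
      mul_le_mul_of_nonneg_left (le_mul_of_one_le_left hw e.one_lt_δ.le) hA
    have h4 := mul_le_mul (h3.trans h1) (h.height_le ht hv) hu.le
      (mul_pos h.ε_pos h.ω_pos).le
    have h5 := mul_le_mul_of_nonneg_right h.ε_le h.ω_pos.le
    rw [radialMap, div_le_one h.ω_pos, h2]
    linarith [h.ω_pos]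

theorem abs_radialMap_sub_le (ht : t ∈ Icc 0 h.β) (ht' : t' ∈ Icc 0 h.β)
    (hv : v ∈ Icc (0 : ℝ) 1) (hv' : v' ∈ Icc (0 : ℝ) 1) :
    |h.radialMap t v - h.radialMap t' v'| ≤ h.ε * (|t - t'| + |v - v'|) := by
  have hu := h.height_pos ht hv
  have hu' := h.height_pos ht' hv'
  have hpow : |A ^ (e.δ - 1) * h.height t v ^ e.δ - A ^ (e.δ - 1) * h.height t' v' ^ e.δ|
      ≤ h.ε * h.ω * |h.height t v - h.height t' v'| := by
    refine Convex.norm_image_sub_le_of_norm_hasDerivWithin_le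
      (f := fun u => A ^ (e.δ - 1) * u ^ e.δ)
      (f' := fun u => A ^ (e.δ - 1) * (e.δ * u ^ (e.δ - 1))) (s := Ioc 0 2)
      (fun u hu => ((Real.hasDerivAt_rpow_const (Or.inl hu.1.ne')).const_mul _).hasDerivWithinAt)
      (fun u hu => ?_) (convex_Ioc 0 2) ⟨hu', h.height_le ht' hv'⟩ ⟨hu, h.height_le ht hv⟩
    rw [Real.norm_of_nonneg]
    · exact h.rescaled_deriv_le hu.1 hu.2
    · exact mul_nonneg (Real.rpow_nonneg h.A_pos.le _)
        (mul_nonneg (by linarith [e.one_lt_δ]) (Real.rpow_nonneg hu.1.le _))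
  have hh : |h.height t v - h.height t' v'| ≤ |t - t'| + |v - v'| := by
    have h1 : h.height t v - h.height t' v'
        = lam / A * (Real.sin t' - Real.sin t) + h.ω * (v - v') := by
      unfold height
      ring
    have h2 : |Real.sin t' - Real.sin t| ≤ |t - t'| := by
      rw [abs_sub_comm t]
      exact Real.abs_sin_sub_sin_le t' t
    rw [h1]
    refine (abs_add_le _ _).trans ?_
    rw [abs_mul, abs_mul, abs_of_pos h.ratio_pos, abs_of_pos h.ω_pos]
    refine add_le_add ((mul_le_of_le_one_left (abs_nonneg _) h.ratio_lt.le).trans h2)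
      (mul_le_of_le_one_left (abs_nonneg _) h.ω_le)
  have h2 := mul_le_mul_of_nonneg_left hh (mul_pos h.ε_pos h.ω_pos).le
  rw [radialMap, radialMap, ← sub_div, abs_div, abs_of_pos h.ω_pos, div_le_iff₀ h.ω_pos]
  linarith

/-! ### Orbits with prescribed itineraries -/

/-- The inverse branch of the angular map with the symbol `i`. -/
def branch (i : Fin 2) (z : Icc (0 : ℝ) h.β) (v : Icc (0 : ℝ) 1) : Icc (0 : ℝ) h.β :=
  ⟨(h.exists_angularMap_eq i z.2 v.2).choose, (h.exists_angularMap_eq i z.2 v.2).choose_spec.1⟩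

theorem angularMap_branch (i : Fin 2) (z : Icc (0 : ℝ) h.β) (v : Icc (0 : ℝ) 1) :
    h.angularMap (h.branch i z v) v = z + 2 * Real.pi * (h.k₀ + (i : ℕ)) :=
  (h.exists_angularMap_eq i z.2 v.2).choose_spec.2

/-- A sequence of points is an orbit with the itinerary `k` exactly if it is a fixed point. -/
def orbitOperator (k : ℤ → Fin 2) (P : ℤ → h.Rect) (n : ℤ) : h.Rect :=
  (h.branch (k n) (P (n + 1)).1 (P n).2,
    ⟨h.radialMap (P (n - 1)).1 (P (n - 1)).2, h.radialMap_mem (P (n - 1)).1.2 (P (n - 1)).2.2⟩)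

/-- The contraction rate of `Horseshoe.orbitOperator`. -/
def rate : ℝ := (1 + h.ε) / (1 + 3 * h.ε)

theorem rate_nonneg : 0 ≤ h.rate :=
  div_nonneg (by linarith [h.ε_pos]) (by linarith [h.ε_pos])

theorem rate_lt_one : h.rate < 1 :=
  (div_lt_one (by linarith [h.ε_pos])).2 (by linarith [h.ε_pos])

/-- The angular equation gives (1 + 3ε)|t - t'| ≤ D + εD: one D from the next angle, εD from the
change of v. The radial component contributes at most 2εD, which is below the same rate. -/
theorem isLocalContraction_orbitOperator (k : ℤ → Fin 2) :
    IsLocalContraction h.rate (h.orbitOperator k) := by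
  intro n D P Q hPQ
  have hsplit : ∀ m : ℤ, |m - n| ≤ 1 →
      |((P m).1 : ℝ) - (Q m).1| ≤ D ∧ |((P m).2 : ℝ) - (Q m).2| ≤ D := fun m hm =>
    max_le_iff.1 (hPQ m hm)
  have hD : 0 ≤ D := dist_nonneg.trans (hPQ n (by simp))
  have hε := h.ε_pos
  refine max_le ?_ ?_
  · change |((h.branch (k n) (P (n + 1)).1 (P n).2 : Icc (0 : ℝ) h.β) : ℝ)
      - (h.branch (k n) (Q (n + 1)).1 (Q n).2 : Icc (0 : ℝ) h.β)| ≤ _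
    set t := h.branch (k n) (P (n + 1)).1 (P n).2 with ht
    set t' := h.branch (k n) (Q (n + 1)).1 (Q n).2 with ht'
    have h1 := h.mul_abs_sub_le_abs_angularMap_sub t.2 t'.2 (P n).2.2
    have h2 := h.abs_angularMap_sub_le t'.2 (P n).2.2 (Q n).2.2
    have h3 : h.angularMap t (P n).2 - h.angularMap t' (Q n).2
        = ((P (n + 1)).1 : ℝ) - (Q (n + 1)).1 := by
      rw [ht, ht', angularMap_branch, angularMap_branch]
      ring
    have h4 := (hsplit (n + 1) (by simp)).1
    have h5 := mul_le_mul_of_nonneg_left (hsplit n (by simp)).2 hε.le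
    -- The expansion estimate compares angles at equal v, so v is first changed at the fixed angle
    -- t'.
    have h6 : |h.angularMap t (P n).2 - h.angularMap t' (P n).2| ≤ D + h.ε * D := by
      have : h.angularMap t (P n).2 - h.angularMap t' (P n).2
          = (((P (n + 1)).1 : ℝ) - (Q (n + 1)).1)
            - (h.angularMap t' (P n).2 - h.angularMap t' (Q n).2) := by
        linarith
      rw [this]
      refine (abs_sub _ _).trans ?_
      linarith
    rw [rate, div_mul_eq_mul_div, le_div_iff₀ (by linarith)]
    linarith
  · change |h.radialMap (P (n - 1)).1 (P (n - 1)).2 - h.radialMap (Q (n - 1)).1 (Q (n - 1)).2| ≤ _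
    have h1 := h.abs_radialMap_sub_le (P (n - 1)).1.2 (Q (n - 1)).1.2 (P (n - 1)).2.2
      (Q (n - 1)).2.2
    obtain ⟨h2, h3⟩ := hsplit (n - 1) (by simp)
    have h4 := mul_le_mul_of_nonneg_left (add_le_add h2 h3) hε.le
    have h5 : 2 * h.ε ≤ h.rate := by
      rw [rate, le_div_iff₀ (by linarith)]
      nlinarith [h.ε_le]
    have h6 := mul_le_mul_of_nonneg_right h5 hD
    linarith

theorem exists_dist_le : ∃ C : ℝ, ∀ x y : h.Rect, dist x y ≤ C :=
  ⟨Metric.diam (univ : Set h.Rect), fun x y =>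
    Metric.dist_le_diam_of_mem isCompact_univ.isBounded (mem_univ x) (mem_univ y)⟩

theorem exists_orbit (k : ℤ → Fin 2) : ∃ P : ℤ → h.Rect, h.orbitOperator k P = P :=
  (h.isLocalContraction_orbitOperator k).exists_fixedPoint h.rate_nonneg h.rate_lt_one
    h.exists_dist_le.choose_spec

/-- The orbit with the itinerary `k`. -/
def orbit (k : ℤ → Fin 2) : ℤ → h.Rect := (h.exists_orbit k).choose

theorem orbitOperator_orbit (k : ℤ → Fin 2) : h.orbitOperator k (h.orbit k) = h.orbit k :=
  (h.exists_orbit k).choose_spec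

theorem orbit_unique {k : ℤ → Fin 2} {P : ℤ → h.Rect} (hP : h.orbitOperator k P = P) :
    P = h.orbit k :=
  (h.isLocalContraction_orbitOperator k).fixedPoint_unique h.rate_nonneg h.rate_lt_one
    h.exists_dist_le.choose_spec hP (h.orbitOperator_orbit k)

theorem continuous_orbit : Continuous fun k => h.orbit k 0 :=
  IsLocalContraction.continuous_fixedPoint h.isLocalContraction_orbitOperator h.rate_nonneg
    h.rate_lt_one h.exists_dist_le.choose_spec
    (fun k k' R n hn => by simp only [orbitOperator, hn]) h.orbitOperator_orbit

theorem angularMap_orbit (k : ℤ → Fin 2) (n : ℤ) :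
    h.angularMap (h.orbit k n).1 (h.orbit k n).2
      = (h.orbit k (n + 1)).1 + 2 * Real.pi * (h.k₀ + (k n : ℕ)) := by
  have h1 : h.branch (k n) (h.orbit k (n + 1)).1 (h.orbit k n).2 = (h.orbit k n).1 :=
    congrArg Prod.fst (congrFun (h.orbitOperator_orbit k) n)
  rw [← angularMap_branch, h1]

theorem radialMap_orbit (k : ℤ → Fin 2) (n : ℤ) :
    h.radialMap (h.orbit k n).1 (h.orbit k n).2 = (h.orbit k (n + 1)).2 := by
  have h1 := congrArg (fun p : h.Rect => (p.2 : ℝ)) (congrFun (h.orbitOperator_orbit k) (n + 1))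
  simpa [orbitOperator] using h1

/-- The shifted orbit is a fixed point of the operator of the shifted itinerary, so uniqueness
identifies the two. -/
theorem orbit_shift (k : ℤ → Fin 2) (n : ℤ) :
    h.orbit (fun m => k (1 + m)) n = h.orbit k (1 + n) := by
  refine (congrFun (h.orbit_unique (P := fun n => h.orbit k (1 + n)) (funext fun n => ?_)) n).symm
  conv_rhs => rw [← h.orbitOperator_orbit k]
  simp only [orbitOperator, add_assoc, add_sub_assoc]

end Horseshoe

/-! ### Injectivity and derivative of the return map -/

namespace SaddleFoci

variable (e : SaddleFoci) (A lam : ℝ)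

/-- The points that the transition maps into `{0 < y}`. -/
def upperDomain : Set Cyl := {p | 0 < p.2 + A + lam * p.1.sin}

theorem isOpen_upperDomain : IsOpen (upperDomain A lam) := by
  have := Real.Angle.continuous_sin
  exact isOpen_lt continuous_const (by fun_prop)

/-- The second coordinate of the image determines the transition height, hence the rotation; then x
and finally y are recovered. -/
theorem injOn_returnMap : InjOn (e.returnMap A lam) (upperDomain A lam) := by
  intro p hp q hq hpq
  rw [e.returnMap_eq A lam p hp, e.returnMap_eq A lam q hq, Prod.mk.injEq] at hpq
  have hs := (Real.rpow_left_inj (le_of_lt hp) (le_of_lt hq)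
    (by linarith [e.one_lt_δ] : e.δ ≠ 0)).1 hpq.2
  have h1 := hpq.1
  rw [hs] at h1
  have hx : p.1 = q.1 := sub_left_injective h1
  refine Prod.ext hx ?_
  rw [hx] at hs
  linarith

/-- The derivative of the transition height `y + A + lam * sin x`. -/
def heightDeriv (p : Cyl) : ℝ × ℝ →L[ℝ] ℝ :=
  (lam * p.1.cos) • ContinuousLinearMap.fst ℝ ℝ ℝ + ContinuousLinearMap.snd ℝ ℝ ℝ

/-- The derivative of the return map. -/
def returnDeriv (p : Cyl) : ℝ × ℝ →L[ℝ] ℝ × ℝ :=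
  (ContinuousLinearMap.fst ℝ ℝ ℝ
    - (e.Kω / (p.2 + A + lam * p.1.sin)) • heightDeriv lam p).prod
  ((e.δ * (p.2 + A + lam * p.1.sin) ^ (e.δ - 1)) • heightDeriv lam p)

theorem returnDeriv_apply (p : Cyl) (v : ℝ × ℝ) :
    e.returnDeriv A lam p v =
      (v.1 - e.Kω / (p.2 + A + lam * p.1.sin) * (lam * p.1.cos * v.1 + v.2),
        e.δ * (p.2 + A + lam * p.1.sin) ^ (e.δ - 1) * (lam * p.1.cos * v.1 + v.2)) := by
  simp [returnDeriv, heightDeriv, mul_add]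

theorem hasCylDerivAt_returnMap {p : Cyl} (hp : p ∈ upperDomain A lam) :
    HasCylDerivAt (e.returnMap A lam) (e.returnDeriv A lam p) p := by
  have hproj : Continuous cylProj :=
    (Real.Angle.continuous_coe.comp continuous_fst).prodMk continuous_snd
  have hq : cylProj (p.1.toReal, p.2) = p := Prod.ext (Real.Angle.coe_toReal _) rfl
  refine ⟨fun z => (z.1 - e.Kω * Real.log (z.2 + A + lam * Real.sin z.1),
    (z.2 + A + lam * Real.sin z.1) ^ e.δ), (p.1.toReal, p.2), hq, ?_, ?_⟩
  · have : ∀ᶠ z in 𝓝 (p.1.toReal, p.2), cylProj z ∈ upperDomain A lam :=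
      hproj.continuousAt.eventually
        ((isOpen_upperDomain A lam).mem_nhds (by rw [hq]; exact hp))
    filter_upwards [this] with z hz
    rw [e.returnMap_eq A lam _ hz]
    simp [cylProj]
  · have hs : 0 < p.2 + A + lam * Real.sin p.1.toReal := by
      rw [Real.Angle.sin_toReal]
      exact hp
    have hh : HasFDerivAt (fun z : ℝ × ℝ => z.2 + A + lam * Real.sin z.1)
        (heightDeriv lam p) (p.1.toReal, p.2) := by
      have h1 := (((hasFDerivAt_fst (𝕜 := ℝ) (p := (p.1.toReal, p.2))).sin.const_mul lam).add
        ((hasFDerivAt_snd (𝕜 := ℝ) (p := (p.1.toReal, p.2))).add_const A))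
      refine (h1.congr_fderiv ?_).congr_of_eventuallyEq (Eventually.of_forall fun z => ?_)
      · rw [heightDeriv, Real.Angle.cos_toReal, smul_smul]
      · simp only [Pi.add_apply]
        ring
    have hlog := hh.log hs.ne'
    have hpow := hh.rpow_const (p := e.δ) (Or.inl hs.ne')
    refine ((hasFDerivAt_fst.sub (hlog.const_mul e.Kω)).prodMk hpow).congr_fderiv ?_
    simp only [Real.Angle.sin_toReal, returnDeriv, smul_smul, div_eq_mul_inv]

theorem continuousOn_returnDeriv :
    ContinuousOn (e.returnDeriv A lam) (upperDomain A lam) := by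
  have hsin := Real.Angle.continuous_sin
  have hcos := Real.Angle.continuous_cos
  have hs : Continuous fun p : Cyl => p.2 + A + lam * p.1.sin := by fun_prop
  have hh : Continuous (heightDeriv lam) := by
    unfold heightDeriv
    fun_prop
  have hne : ∀ p ∈ upperDomain A lam, p.2 + A + lam * p.1.sin ≠ 0 := fun p hp => ne_of_gt hp
  have h1 : ContinuousOn (fun p : Cyl => ContinuousLinearMap.fst ℝ ℝ ℝ
      - (e.Kω / (p.2 + A + lam * p.1.sin)) • heightDeriv lam p) (upperDomain A lam) :=
    continuousOn_const.sub ((continuousOn_const.div hs.continuousOn hne).smul hh.continuousOn)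
  have h2 : ContinuousOn (fun p : Cyl =>
      (e.δ * (p.2 + A + lam * p.1.sin) ^ (e.δ - 1)) • heightDeriv lam p) (upperDomain A lam) :=
    (continuousOn_const.mul (hs.continuousOn.rpow_const fun p hp => Or.inl (hne p hp))).smul
      hh.continuousOn
  exact (ContinuousLinearMap.prodₗᵢ ℝ).continuous.comp_continuousOn (h1.prodMk h2)

theorem bijective_returnDeriv {p : Cyl} (hp : p ∈ upperDomain A lam) :
    Function.Bijective (e.returnDeriv A lam p) := by
  have hinj : Function.Injective (e.returnDeriv A lam p : ℝ × ℝ →ₗ[ℝ] ℝ × ℝ) := by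
    rw [← LinearMap.ker_eq_bot, LinearMap.ker_eq_bot']
    intro v hv
    rw [ContinuousLinearMap.coe_coe, returnDeriv_apply, Prod.mk_eq_zero] at hv
    have hd : e.δ * (p.2 + A + lam * p.1.sin) ^ (e.δ - 1) ≠ 0 :=
      (mul_pos (by linarith [e.one_lt_δ]) (Real.rpow_pos_of_pos hp _)).ne'
    have h1 := (mul_eq_zero.1 hv.2).resolve_left hd
    have h2 : v.1 = 0 := by simpa [h1] using hv.1
    have h3 : v.2 = 0 := by simpa [h2] using h1
    exact Prod.ext h2 h3
  exact ⟨hinj, LinearMap.injective_iff_surjective.1 hinj⟩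

end SaddleFoci

/-! ### The rectangle in the cylinder and the coding of its orbits -/

namespace Horseshoe

open SaddleFoci

variable {e : SaddleFoci} {A lam : ℝ} (h : Horseshoe e A lam)

/-- The height of the rectangle. -/
def scale : ℝ := A * h.ω

theorem scale_pos : 0 < h.scale := mul_pos h.A_pos h.ω_pos

theorem scale_le : h.scale ≤ 1 / 2 :=
  (mul_le_of_le_one_right h.A_pos.le h.ω_le).trans h.A_le

/-- The embedding of the rectangle into the cylinder. -/
def point (P : h.Rect) : Cyl := (((Real.pi + P.1 : ℝ) : Real.Angle), h.scale * P.2)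

theorem continuous_point : Continuous h.point := by
  have := Real.Angle.continuous_coe
  unfold point
  fun_prop

theorem transition_height (P : h.Rect) :
    (h.point P).2 + A + lam * (h.point P).1.sin = A * h.height P.1 P.2 := by
  have hA := h.A_pos.ne'
  simp only [point, Real.Angle.sin_coe, height, scale]
  rw [add_comm Real.pi, Real.sin_add_pi]
  field_simp
  ring

theorem point_mem_upperDomain (P : h.Rect) : h.point P ∈ upperDomain A lam := by
  rw [upperDomain, mem_ofPred_eq, transition_height]
  exact mul_pos h.A_pos (h.height_pos P.1.2 P.2.2)

theorem point_mem (P : h.Rect) : h.point P ∈ outPlus ∩ returnDomain A lam := by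
  have hu := mul_le_mul_of_nonneg_left (h.height_le P.1.2 P.2.2) h.A_pos.le
  refine ⟨⟨mul_nonneg h.scale_pos.le P.2.2.1, ?_⟩, h.point_mem_upperDomain P, ?_⟩
  · exact mul_le_one₀ (by linarith [h.scale_le]) P.2.2.1 P.2.2.2
  · change (h.point P).2 + A + lam * (h.point P).1.sin ≤ 1
    rw [transition_height]
    linarith [h.A_le]

theorem point_injective : Function.Injective h.point := by
  intro P Q hPQ
  have h1 := congrArg Prod.fst hPQ
  have h2 := congrArg Prod.snd hPQ
  simp only [point] at h1 h2
  have hP := P.1.2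
  have hQ := Q.1.2
  have hβ := h.β_lt
  refine Prod.ext (Subtype.ext ?_) (Subtype.ext (mul_left_cancel₀ h.scale_pos.ne' h2))
  rw [Real.Angle.coe_add, Real.Angle.coe_add] at h1
  have h3 := congrArg Real.Angle.toReal (add_left_cancel h1)
  rwa [Real.Angle.toReal_coe_eq_self_iff.2 ⟨by linarith [hP.1, Real.pi_pos], by linarith [hP.2, Real.pi_pos]⟩,
    Real.Angle.toReal_coe_eq_self_iff.2 ⟨by linarith [hQ.1, Real.pi_pos], by linarith [hQ.2, Real.pi_pos]⟩]
    at h3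

theorem returnMap_orbit (k : ℤ → Fin 2) (n : ℤ) :
    e.returnMap A lam (h.point (h.orbit k n)) = h.point (h.orbit k (n + 1)) := by
  have hu := h.height_pos (h.orbit k n).1.2 (h.orbit k n).2.2
  have hA := h.A_pos
  have h1 := h.angularMap_orbit k n
  have h2 := h.radialMap_orbit k n
  rw [e.returnMap_eq A lam _ (h.point_mem_upperDomain _), transition_height]
  refine Prod.ext ?_ ?_
  · simp only [point]
    rw [← Real.Angle.coe_sub, Real.Angle.angle_eq_iff_two_pi_dvd_sub]
    -- The number of full turns made at this step.
    refine ⟨h.k₀ + (k n : ℕ), ?_⟩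
    rw [Real.log_mul hA.ne' hu.ne']
    rw [angularMap] at h1
    push_cast
    linarith
  · simp only [point]
    rw [← h2, radialMap, scale, Real.mul_rpow hA.le hu.le, Real.rpow_sub_one hA.ne']
    have := h.ω_pos.ne'
    field_simp

/-- The point of the horseshoe with the itinerary `k`. -/
def coding (k : ℤ → Fin 2) : Cyl := h.point (h.orbit k 0)

theorem continuous_coding : Continuous h.coding := h.continuous_point.comp h.continuous_orbit

theorem orbit_comp_shift (k : ℤ → Fin 2) (n : ℤ) :
    h.orbit (SymbolicDynamics.FullShift.shift (1 : ℤ) k) n = h.orbit k (1 + n) :=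
  h.orbit_shift k n

theorem returnMap_coding (k : ℤ → Fin 2) :
    e.returnMap A lam (h.coding k)
      = h.coding (SymbolicDynamics.FullShift.shift (1 : ℤ) k) := by
  rw [coding, coding, returnMap_orbit, orbit_comp_shift, add_comm]

/-- Equal points have equal forward orbits, and equal backward orbits because the return map is
injective. The number of turns in the angular equation then reveals each symbol. -/
theorem coding_injective : Function.Injective h.coding := by
  intro k k' hkk'
  have hzero : h.orbit k 0 = h.orbit k' 0 := h.point_injective hkk'
  have hall : ∀ n, h.orbit k n = h.orbit k' n := by
    intro n
    induction n using Int.induction_on with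
    | zero => exact hzero
    | succ n ih =>
      apply h.point_injective
      rw [← returnMap_orbit, ← returnMap_orbit, ih]
    | pred n ih =>
      apply h.point_injective
      refine e.injOn_returnMap A lam (h.point_mem_upperDomain _) (h.point_mem_upperDomain _) ?_
      rw [returnMap_orbit, returnMap_orbit, sub_add_cancel, ih]
  funext n
  have h1 := h.angularMap_orbit k n
  rw [hall n, hall (n + 1), h.angularMap_orbit k' n] at h1
  have h2 := mul_left_cancel₀ (by positivity : 2 * Real.pi ≠ 0) (add_left_cancel h1)
  exact Fin.ext (by exact_mod_cast (add_left_cancel h2).symm)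

/-- The entries of the derivative along an orbit, with the height measured in units of
`Horseshoe.scale`. -/
theorem isDominated_returnDeriv (P : h.Rect) :
    ∃ a b c d, IsDominated h.ε a b c d ∧ ∀ x y : ℝ,
      e.returnDeriv A lam (h.point P) (x, h.scale * y)
        = (a * x + b * y, h.scale * (c * x + d * y)) := by
  have hA := h.A_pos
  have hω := h.ω_pos
  have hu := h.height_pos P.1.2 P.2.2
  have hu2 := h.height_le P.1.2 P.2.2
  set u := h.height P.1 P.2 with hudef
  have hcos := h.cos_le_cos P.1.2
  have hK := e.Kω_pos
  have hε := h.ε_pos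
  set D := A ^ (e.δ - 1) * (e.δ * u ^ (e.δ - 1)) with hD
  have hD0 : 0 ≤ D := mul_nonneg (Real.rpow_nonneg hA.le _)
    (mul_nonneg (by linarith [e.one_lt_δ]) (Real.rpow_nonneg hu.le _))
  have hDle : D ≤ h.ε * h.ω := h.rescaled_deriv_le hu hu2
  refine ⟨1 + e.Kω * (lam / A * Real.cos P.1) / u, -(e.Kω * h.ω / u),
    -(D * (lam / A * Real.cos P.1) / h.ω), D, ⟨hε, h.ε_le, ?_, ?_, ?_, ?_⟩, fun x y => ?_⟩
  · have h1 : 3 * h.ε ≤ e.Kω * (lam / A * Real.cos P.1) / u := by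
      rw [le_div_iff₀ hu]
      have h2 := mul_le_mul_of_nonneg_left hcos (mul_pos hK h.ratio_pos).le
      have h3 := mul_le_mul_of_nonneg_left hu2 (by linarith : 0 ≤ 3 * h.ε)
      linarith [h.expand]
    linarith
  · rw [abs_neg, abs_of_pos (div_pos (mul_pos hK hω) hu), div_le_iff₀ hu]
    exact h.bend.trans (mul_le_mul_of_nonneg_left (h.gap_le_height P.1.2 P.2.2) hε.le)
  · have h1 : |lam / A * Real.cos P.1| ≤ 1 := by
      rw [abs_mul, abs_of_pos h.ratio_pos]
      exact mul_le_one₀ h.ratio_lt.le (abs_nonneg _) (Real.abs_cos_le_one _)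
    rw [abs_neg, abs_div, abs_mul, abs_of_pos hω, abs_of_nonneg hD0, div_le_iff₀ hω]
    exact (mul_le_of_le_one_right hD0 h1).trans hDle
  · rw [abs_of_nonneg hD0]
    exact hDle.trans (mul_le_of_le_one_right hε.le h.ω_le)
  · rw [returnDeriv_apply, transition_height, ← hudef, Real.mul_rpow hA.le hu.le]
    have hc : (h.point P).1.cos = -Real.cos P.1 := by
      simp only [point, Real.Angle.cos_coe]
      rw [add_comm, Real.cos_add_pi]
    rw [hc, hD, scale]
    refine Prod.ext ?_ ?_
    · field_simp
      ring
    · field_simp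

end Horseshoe

/-! ### Hyperbolicity and conjugacy -/

namespace Horseshoe

open SaddleFoci SymbolicDynamics.FullShift

variable {e : SaddleFoci} {A lam : ℝ} (h : Horseshoe e A lam)

/-- Slopes of the stable and unstable directions over the horseshoe. -/
theorem exists_slopes : ∃ σ τ : (ℤ → Fin 2) → ℝ, ∀ k,
    (|σ k| ≤ 1 / 2 ∧ ∃ m, |m| ≤ 2 * h.ε ∧
      e.returnDeriv A lam (h.coding k) (σ k, h.scale) = m • (σ (shift (1 : ℤ) k), h.scale)) ∧
    (|τ k| ≤ 1 / 2 ∧ ∃ m, 1 + 2 * h.ε ≤ m ∧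
      e.returnDeriv A lam (h.coding k) (1, h.scale * τ k)
        = m • (1, h.scale * τ (shift (1 : ℤ) k))) := by
  choose a b c d hdom hD using h.isDominated_returnDeriv
  have hst := fun k => existsUnique_stable_slopes (fun n : ℤ => hdom (h.orbit k n))
  have hun := fun k => existsUnique_unstable_slopes (fun n : ℤ => hdom (h.orbit k n))
  choose σ hσ hσu using hst
  choose τ hτ hτu using hun
  simp only at hσ hτ hσu hτu
  -- Shifting the slope sequence of k solves the equations of the shifted itinerary, so uniqueness
  -- makes the slopes equivariant.
  have hσs : ∀ k, σ (shift (1 : ℤ) k) 0 = σ k 1 := fun k => by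
    have := hσu (shift (1 : ℤ) k) (fun n => σ k (1 + n)) ⟨fun n => (hσ k).1 _, fun n => by
      simpa only [orbit_comp_shift, add_assoc] using (hσ k).2 (1 + n)⟩
    exact (congrFun this 0).symm
  have hτs : ∀ k, τ (shift (1 : ℤ) k) 0 = τ k 1 := fun k => by
    have := hτu (shift (1 : ℤ) k) (fun n => τ k (1 + n)) ⟨fun n => (hτ k).1 _, fun n => by
      simpa only [orbit_comp_shift, add_assoc] using (hτ k).2 (1 + n)⟩
    exact (congrFun this 0).symm
  refine ⟨fun k => σ k 0, fun k => τ k 0, fun k => ⟨⟨(hσ k).1 0, ?_⟩, (hτ k).1 0, ?_⟩⟩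
  · refine ⟨c (h.orbit k 0) * σ k 0 + d (h.orbit k 0), ?_, ?_⟩
    · have hdom0 := hdom (h.orbit k 0)
      refine (abs_add_le _ _).trans ?_
      rw [abs_mul]
      have := mul_le_mul hdom0.hc ((hσ k).1 0) (abs_nonneg _) hdom0.pos.le
      linarith [hdom0.hd, hdom0.pos]
    · have h1 := hD (h.orbit k 0) (σ k 0) 1
      have h2 := (hσ k).2 0
      simp only [coding, hσs]
      rw [mul_one, mul_one, mul_one, h2, zero_add] at h1
      rw [h1, Prod.smul_mk, smul_eq_mul, smul_eq_mul, mul_comm h.scale]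
  · refine ⟨a (h.orbit k 0) + b (h.orbit k 0) * τ k 0,
      (hdom (h.orbit k 0)).one_le_denom ((hτ k).1 0), ?_⟩
    have h1 := hD (h.orbit k 0) 1 (τ k 0)
    have h2 := (hτ k).2 0
    simp only [coding, hτs]
    rw [mul_one, mul_one, h2, zero_add] at h1
    rw [h1, Prod.smul_mk, smul_eq_mul, smul_eq_mul, mul_one, mul_left_comm]

theorem norm_iterDeriv_stable_le {σ : (ℤ → Fin 2) → ℝ}
    (hσ : ∀ k, |σ k| ≤ 1 / 2 ∧ ∃ m, |m| ≤ 2 * h.ε ∧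
      e.returnDeriv A lam (h.coding k) (σ k, h.scale) = m • (σ (shift (1 : ℤ) k), h.scale))
    (n : ℕ) : ∀ k,
      ‖iterDeriv (e.returnMap A lam) (e.returnDeriv A lam) n (h.coding k) (σ k, h.scale)‖
        ≤ (2 * h.ε) ^ n := by
  induction n with
  | zero =>
    intro k
    have h1 : ‖σ k‖ ≤ 1 := (hσ k).1.trans (by norm_num)
    have h2 : ‖h.scale‖ ≤ 1 := by
      rw [Real.norm_of_nonneg h.scale_pos.le]
      linarith [h.scale_le]
    simpa [iterDeriv, Prod.norm_def] using ⟨h1, h2⟩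
  | succ n ih =>
    intro k
    obtain ⟨m, hm, hDm⟩ := (hσ k).2
    simp only [iterDeriv, ContinuousLinearMap.comp_apply]
    rw [hDm, map_smul, norm_smul, returnMap_coding, pow_succ']
    exact mul_le_mul hm (ih _) (norm_nonneg _) (by linarith [h.ε_pos])

theorem le_norm_iterDeriv_unstable {τ : (ℤ → Fin 2) → ℝ}
    (hτ : ∀ k, |τ k| ≤ 1 / 2 ∧ ∃ m, 1 + 2 * h.ε ≤ m ∧
      e.returnDeriv A lam (h.coding k) (1, h.scale * τ k)
        = m • (1, h.scale * τ (shift (1 : ℤ) k)))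
    (n : ℕ) : ∀ k, (1 + 2 * h.ε) ^ n ≤
      ‖iterDeriv (e.returnMap A lam) (e.returnDeriv A lam) n (h.coding k) (1, h.scale * τ k)‖ := by
  induction n with
  | zero =>
    intro k
    simp [iterDeriv, Prod.norm_def]
  | succ n ih =>
    intro k
    have hε := h.ε_pos
    obtain ⟨m, hm, hDm⟩ := (hτ k).2
    simp only [iterDeriv, ContinuousLinearMap.comp_apply]
    rw [hDm, map_smul, norm_smul, returnMap_coding, pow_succ']
    exact mul_le_mul (hm.trans (le_abs_self m)) (ih _) (by positivity) (norm_nonneg _)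

/-- The determinant of the two spanning vectors is, up to sign, ρ(1 - στ), and |στ| ≤ 1/4. -/
theorem isCompl_span_of_slopes {σ τ ρ : ℝ} (hρ : ρ ≠ 0) (hσ : |σ| ≤ 1 / 2) (hτ : |τ| ≤ 1 / 2) :
    IsCompl (Submodule.span ℝ {((σ, ρ) : ℝ × ℝ)}) (Submodule.span ℝ {((1, ρ * τ) : ℝ × ℝ)}) := by
  have hστ : |σ * τ| < 1 := by
    rw [abs_mul]
    have := mul_le_mul hσ hτ (abs_nonneg _) (by norm_num)
    linarith
  have hdet : 1 - σ * τ ≠ 0 := by linarith [(abs_lt.1 hστ).2]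
  constructor
  · rw [Submodule.disjoint_def]
    intro v hv hv'
    obtain ⟨x, rfl⟩ := Submodule.mem_span_singleton.1 hv
    obtain ⟨y, hy⟩ := Submodule.mem_span_singleton.1 hv'
    rw [Prod.smul_mk, Prod.smul_mk, Prod.mk.injEq] at hy
    simp only [smul_eq_mul, mul_one] at hy
    have h1 : ρ * (x * (1 - σ * τ)) = 0 := by
      rw [hy.1] at hy
      linarith [hy.2]
    have h2 : x = 0 := ((mul_eq_zero.1 ((mul_eq_zero.1 h1).resolve_left hρ)).resolve_right hdet)
    simp [h2]
  · rw [codisjoint_iff, Submodule.eq_top_iff']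
    rintro ⟨x, y⟩
    rw [Submodule.mem_sup]
    refine ⟨_, Submodule.smul_mem _ ((y / ρ - x * τ) / (1 - σ * τ))
      (Submodule.mem_span_singleton_self _), _,
      Submodule.smul_mem _ ((x - σ * (y / ρ)) / (1 - σ * τ))
      (Submodule.mem_span_singleton_self _), ?_⟩
    simp only [Prod.smul_mk, smul_eq_mul, Prod.mk_add_mk]
    refine Prod.ext ?_ ?_
    · simp only
      rw [mul_one, div_mul_eq_mul_div, ← add_div, div_eq_iff hdet]
      ring
    · simp only
      rw [div_mul_eq_mul_div, div_mul_eq_mul_div, ← add_div, div_eq_iff hdet]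
      field_simp
      ring

theorem map_span_eq_of_smul {L : ℝ × ℝ →L[ℝ] ℝ × ℝ} (hL : Function.Injective L) {v w : ℝ × ℝ}
    (hv : v ≠ 0) {m : ℝ} (hm : L v = m • w) :
    (Submodule.span ℝ {v}).map (L : ℝ × ℝ →ₗ[ℝ] ℝ × ℝ) = Submodule.span ℝ {w} := by
  have hm0 : m ≠ 0 := by
    rintro rfl
    exact hv (hL (by rw [hm, zero_smul, map_zero]))
  rw [Submodule.map_span, image_singleton, ContinuousLinearMap.coe_coe, hm,
    Submodule.span_singleton_smul_eq (isUnit_iff_ne_zero.2 hm0)]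

theorem isHyperbolicSet : IsHyperbolicSet (e.returnMap A lam) (range h.coding) := by
  obtain ⟨σ, τ, hστ⟩ := h.exists_slopes
  have hσ := fun k => (hστ k).1
  have hτ := fun k => (hστ k).2
  have hε := h.ε_pos
  have hε4 := h.ε_le
  have hscale := h.scale_pos
  let code := Function.invFun h.coding
  have hcode : ∀ k, code (h.coding k) = k := Function.leftInverse_invFun h.coding_injective
  have hsurj : Function.Surjective (shift (1 : ℤ) : (ℤ → Fin 2) → ℤ → Fin 2) := fun k =>
    ⟨fun n => k (n - 1), funext fun n => by simp⟩
  have hU : range h.coding ⊆ upperDomain A lam := by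
    rintro _ ⟨k, rfl⟩
    exact h.point_mem_upperDomain _
  -- The rate 1/(1 + 2ε) serves both directions, since 2ε(1 + 2ε) ≤ 1 for ε ≤ 1/4. The constant
  -- 1/scale compensates for the stable spanning vector, whose norm is only known to be at least
  -- `h.scale`.
  refine ⟨isCompact_range h.continuous_coding, ?_, upperDomain A lam, e.returnDeriv A lam,
    isOpen_upperDomain A lam, hU, e.injOn_returnMap A lam,
    fun p hp => e.hasCylDerivAt_returnMap A lam hp, e.continuousOn_returnDeriv A lam,
    fun p hp => e.bijective_returnDeriv A lam hp,
    fun p => Submodule.span ℝ {(σ (code p), h.scale)},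
    fun p => Submodule.span ℝ {(1, h.scale * τ (code p))}, 1 / h.scale, 1 / (1 + 2 * h.ε),
    by positivity, by positivity, (div_lt_one (by linarith)).2 (by linarith), ?_⟩
  · rw [← range_comp, ← hsurj.range_comp h.coding]
    exact congrArg range (funext h.returnMap_coding)
  · rintro _ ⟨k, rfl⟩
    have hinj := (e.bijective_returnDeriv A lam (hU ⟨k, rfl⟩)).1
    have hscale1 : 1 ≤ 1 / h.scale := (one_le_div hscale).2 (by linarith [h.scale_le])
    simp only [returnMap_coding, hcode]
    obtain ⟨m, -, hm⟩ := (hσ k).2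
    obtain ⟨m', -, hm'⟩ := (hτ k).2
    refine ⟨isCompl_span_of_slopes hscale.ne' (hσ k).1 (hτ k).1,
      map_span_eq_of_smul hinj (by simp [hscale.ne']) hm,
      map_span_eq_of_smul hinj (by simp) hm', fun v hv n => ?_, fun v hv n => ?_⟩
    · obtain ⟨x, rfl⟩ := Submodule.mem_span_singleton.1 hv
      have h1 := h.norm_iterDeriv_stable_le hσ n k
      have h2 : h.scale ≤ ‖((σ k, h.scale) : ℝ × ℝ)‖ :=
        (le_abs_self _).trans (norm_snd_le ((σ k, h.scale) : ℝ × ℝ))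
      have h3 : (2 * h.ε) ^ n ≤ (1 / (1 + 2 * h.ε)) ^ n := by
        refine pow_le_pow_left₀ (by linarith) ?_ n
        rw [le_div_iff₀ (by linarith)]
        nlinarith
      have h4 : 1 ≤ 1 / h.scale * ‖((σ k, h.scale) : ℝ × ℝ)‖ := by
        rw [one_div_mul_eq_div]
        exact (one_le_div hscale).2 h2
      have h5 : 0 ≤ (1 / (1 + 2 * h.ε)) ^ n := by positivity
      rw [map_smul, norm_smul, norm_smul]
      have h6 := mul_le_mul_of_nonneg_left (h1.trans (h3.trans (le_mul_of_one_le_right h5 h4)))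
        (norm_nonneg x)
      linarith
    · obtain ⟨x, rfl⟩ := Submodule.mem_span_singleton.1 hv
      have h1 := h.le_norm_iterDeriv_unstable hτ n k
      have h2 : ‖((1, h.scale * τ k) : ℝ × ℝ)‖ ≤ 1 := by
        refine (Prod.norm_def _).trans_le (max_le (by simp) ?_)
        rw [norm_mul, Real.norm_of_nonneg hscale.le]
        exact mul_le_one₀ (by linarith [h.scale_le]) (norm_nonneg _)
          ((hτ k).1.trans (by norm_num))
      have h3 : 1 ≤ (1 / (1 + 2 * h.ε)) ^ n * ‖iterDeriv (e.returnMap A lam)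
          (e.returnDeriv A lam) n (h.coding k) (1, h.scale * τ k)‖ := by
        rw [one_div_pow, one_div_mul_eq_div]
        exact (one_le_div (by positivity)).2 h1
      rw [map_smul, norm_smul, norm_smul]
      have h4 := mul_le_mul_of_nonneg_left
        ((h2.trans h3).trans (le_mul_of_one_le_left (by linarith) hscale1)) (norm_nonneg x)
      linarith

theorem isConjFullShift : IsConjFullShift (e.returnMap A lam) (range h.coding) 2 := by
  have hmaps : MapsTo (e.returnMap A lam) (range h.coding) (range h.coding) := by
    rintro _ ⟨k, rfl⟩
    exact ⟨_, (h.returnMap_coding k).symm⟩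
  have hcont : Continuous (Equiv.ofInjective h.coding h.coding_injective) :=
    h.continuous_coding.subtype_mk _
  refine ⟨hmaps, hcont.homeoOfEquivCompactToT2.symm, fun p => ?_⟩
  obtain ⟨k, rfl⟩ := hcont.homeoOfEquivCompactToT2.surjective p
  rw [Homeomorph.symm_apply_apply, Homeomorph.symm_apply_eq]
  exact Subtype.ext (h.returnMap_coding k)

end Horseshoe

/-! ### Choice of the constants -/

/-- For `lam / A` above the threshold and small `A` the return map has a horseshoe. -/
theorem SaddleFoci.exists_horseshoe (e : SaddleFoci) :
    ∃ ε₀ : ℝ, 0 < ε₀ ∧ ∀ A lam : ℝ, 0 < A → A ≤ ε₀ → lam / A < 1 →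
      (Real.exp (4 * Real.pi / e.Kω) - 1) / (Real.exp (4 * Real.pi / e.Kω) - 1 / 4) < lam / A →
      Nonempty (Horseshoe e A lam) := by
  have hK := e.Kω_pos
  have hδ := e.one_lt_δ
  set E := Real.exp (4 * Real.pi / e.Kω) with hE
  have hE1 : 1 < E := Real.one_lt_exp_iff.2 (by positivity)
  have hEK : e.Kω * Real.log E = 4 * Real.pi := by
    rw [hE, Real.log_exp]
    field_simp
  set r₀ := (E - 1) / (E - 1 / 4) with hr₀
  have hE4 : 0 < E - 1 / 4 := by linarith
  have hr₀pos : 0 < r₀ := div_pos (by linarith) hE4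
  have hmE : 0 < 1 / (8 * E) := by positivity
  have hmE1 : 1 / (8 * E) < 1 := (div_lt_one (by linarith)).2 (by linarith)
  -- With this sin β, 1 - r₀ sin β stays strictly below 1/E, while 1 - (lam/A) sin β ≥ 1/(8E) for
  -- every ratio below 1. Hence β, ε and ω do not depend on A or `lam`.
  set β := Real.arcsin (1 - 1 / (8 * E)) with hβ
  have hsin : Real.sin β = 1 - 1 / (8 * E) :=
    Real.sin_arcsin (by linarith) (by linarith)
  have hβpos : 0 < β := Real.arcsin_pos.2 (by linarith)
  have hβlt : β < Real.pi / 2 := Real.arcsin_lt_pi_div_two.2 (by linarith)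
  have hcos : 0 < Real.cos β := Real.cos_pos_of_mem_Ioo ⟨by linarith, hβlt⟩
  have hgap : 0 < 1 / E - (1 - r₀ * Real.sin β) := by
    have : 1 / E - (1 - r₀ * Real.sin β) = (E - 1) / (8 * E * (E - 1 / 4)) := by
      have hr : r₀ * (E - 1 / 4) = E - 1 := div_mul_cancel₀ _ hE4.ne'
      have hinv : 1 / E * E = 1 := div_mul_cancel₀ _ (by linarith)
      have h8 : 1 / (8 * E) = 1 / E / 8 := by ring
      rw [hsin, eq_div_iff (by positivity), h8]
      linear_combination (8 - r₀) * (E - 1 / 4) * hinv + (8 * E - 1) * hr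
    rw [this]
    exact div_pos (by linarith) (by positivity)
  set ε := min (1 / 4) (e.Kω * (r₀ * Real.cos β) / 6) with hε
  have hεpos : 0 < ε := lt_min (by norm_num) (by positivity)
  set ω := min (min 1 (1 / E - (1 - r₀ * Real.sin β))) (ε * (1 / (8 * E)) / e.Kω) with hω
  have hωpos : 0 < ω := lt_min (lt_min one_pos hgap) (by positivity)
  have htend : Tendsto (fun A : ℝ => e.δ * (A ^ (e.δ - 1) * 2 ^ (e.δ - 1))) (𝓝 0) (𝓝 0) := by
    have h1 : ContinuousAt (fun A : ℝ => e.δ * (A ^ (e.δ - 1) * 2 ^ (e.δ - 1))) 0 :=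
      ((Real.continuousAt_rpow_const 0 _ (Or.inr (by linarith))).mul_const _).const_mul _
    simpa [Real.zero_rpow (by linarith : e.δ - 1 ≠ 0)] using h1.tendsto
  obtain ⟨η, hη, hball⟩ := Metric.eventually_nhds_iff.1
    (htend.eventually_lt_const (mul_pos hεpos hωpos))
  refine ⟨min (1 / 2) (η / 2), by positivity, fun A lam hA hAle hlt hgt => ?_⟩
  have hr : 0 < lam / A := hr₀pos.trans hgt
  have hsinpos : 0 < Real.sin β := by rw [hsin]; linarith
  have hrsin : r₀ * Real.sin β ≤ lam / A * Real.sin β :=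
    mul_le_mul_of_nonneg_right hgt.le hsinpos.le
  have hrsin1 : lam / A * Real.sin β ≤ Real.sin β := mul_le_of_le_one_left hsinpos.le hlt.le
  -- Rounding up to k₀ loses less than 2π, and the second symbol needs another 2π. Together they fit
  -- into 4π = Kω log E.
  have hceil := Int.ceil_lt_add_one (-(e.Kω * Real.log A) / (2 * Real.pi))
  have hceil' := Int.le_ceil (-(e.Kω * Real.log A) / (2 * Real.pi))
  rw [div_le_iff₀ (by positivity)] at hceil'
  rw [← sub_lt_iff_lt_add, lt_div_iff₀ (by positivity)] at hceil
  refine ⟨{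
    β := β
    ω := ω
    ε := ε
    k₀ := ⌈-(e.Kω * Real.log A) / (2 * Real.pi)⌉
    A_pos := hA
    A_le := hAle.trans (min_le_left _ _)
    lam_pos := (div_pos_iff_of_pos_right hA).1 hr
    lam_lt := (div_lt_one hA).1 hlt
    β_pos := hβpos
    β_lt := hβlt
    ω_pos := hωpos
    ω_le := (min_le_left _ _).trans (min_le_left _ _)
    ε_pos := hεpos
    ε_le := min_le_left _ _
    expand := ?_
    bend := ?_
    squeeze := ?_
    cover_left := ?_
    cover_right := ?_ }⟩
  · have h1 : ε ≤ e.Kω * (r₀ * Real.cos β) / 6 := min_le_right _ _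
    have h2 := mul_le_mul_of_nonneg_left (mul_le_mul_of_nonneg_right hgt.le hcos.le) hK.le
    linarith
  · have h1 : ω ≤ ε * (1 / (8 * E)) / e.Kω := min_le_right _ _
    rw [le_div_iff₀ hK] at h1
    have h2 : 1 / (8 * E) ≤ 1 - lam / A * Real.sin β := by linarith
    have h3 := mul_le_mul_of_nonneg_left h2 hεpos.le
    linarith
  · refine (hball ?_).le
    rw [Real.dist_eq, sub_zero, abs_of_pos hA]
    linarith [hAle.trans (min_le_right _ _)]
  · linarith
  · have h1 : ω ≤ 1 / E - (1 - r₀ * Real.sin β) := (min_le_left _ _).trans (min_le_right _ _)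
    have h2 : 0 < 1 - lam / A * Real.sin β + ω := by linarith [Real.sin_le_one β]
    have h3 : Real.log (1 - lam / A * Real.sin β + ω) ≤ Real.log (1 / E) :=
      Real.log_le_log h2 (by linarith)
    rw [one_div, Real.log_inv] at h3
    have h4 := mul_le_mul_of_nonneg_left h3 hK.le
    linarith


end

theorem theoremE (e : SaddleFoci) :
    ∃ ε : ℝ, 0 < ε ∧ ∀ A lam : ℝ, 0 < A → A ≤ ε →
      lam / A < 1 →
      (Real.exp (4 * Real.pi / e.Kω) - 1) / (Real.exp (4 * Real.pi / e.Kω) - 1 / 4) < lam / A →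
      ∃ Λ : Set Cyl, Λ ⊆ outPlus ∩ returnDomain A lam ∧
        IsHyperbolicSet (e.returnMap A lam) Λ ∧
        IsConjFullShift (e.returnMap A lam) Λ 2 := by
  obtain ⟨ε, hε, hε'⟩ := e.exists_horseshoe
  refine ⟨ε, hε, fun A lam hA hAε hlt hgt => ?_⟩
  obtain ⟨h⟩ := hε' A lam hA hAε hlt hgt
  refine ⟨range h.coding, ?_, h.isHyperbolicSet, h.isConjFullShift⟩
  rintro _ ⟨k, rfl⟩
  exact h.point_mem _
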